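/- For integers $1\le k\le \min\{m,n\}$ and a matrix $A\in\mathbb{Z}^{m\times n}$ let $\Delta_k(A)$ denote the largest absolute value of the determinant of a $k\times k$ submatrix of $A$. For positive integers $\Delta,m$, the generalized Heller constant $h(\Delta,m)$ is the maximum of all $n\in\mathbb{Z}_{>0}$ such that there is a matrix $A\in\mathbb{Z}^{m\times n}$ with pairwise distinct columns, $n\ge m$, and $\Delta_m(A)=\Delta$. Theorem. Let $\Delta$ and $m$ be positive integers. The maximum $h(\Delta,m)$ exists, and the following holds. (i) If $m\ge 5$, then $$h(\Delta,m)\;\le\; m^2+m+1+2(\Delta-1)\sum_{i=0}^{4}\binom{m}{i},$$ and the right-hand side belongs to $\mathcal{O}(m^4)\cdot\Delta$: there is an absolute constant $C>0$ such that it is at most $C\,m^4\,\Delta$ for all such $\Delta$ and $m$. (ii) If $m\ge 4$ and $\Delta$ is odd, then $$h(\Delta,m)\;\le\; m^2+m+1+2(\Delta-1)\sum_{i=0}^{3}\binom{m}{i},$$ and the right-hand side belongs to $\mathcal{O}(m^3)\cdot\Delta$: there is an absolute constant $C>0$ such that it is at most $C\,m^3\,\Delta$ for all such $\Delta$ and $m$.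 -/

import Mathlib

/-- `maxMinor k A` is `Δ_k(A)`: the largest absolute value of the determinant of a `k × k`
submatrix of the integer matrix `A`. The submatrix is obtained by choosing `k` rows and `k`
columns (in increasing order). If there is no such submatrix (i.e. `k` exceeds the number of
rows or columns), the value is `0`. -/
noncomputable def maxMinor {m n : ℕ} (k : ℕ) (A : Matrix (Fin m) (Fin n) ℤ) : ℕ :=
  (Finset.univ : Finset ((Fin k ↪o Fin m) × (Fin k ↪o Fin n))).sup
    fun p => (A.submatrix p.1 p.2).det.natAbs

/-- The set of all `n > 0` for which there is an integer `m × n` matrix with pairwise distinct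
columns whose maximal `m × m` minor in absolute value is exactly `Δ`. -/
def hellerSet (Δ m : ℕ) : Set ℕ :=
  {n | 0 < n ∧ ∃ A : Matrix (Fin m) (Fin n) ℤ,
    Function.Injective (fun j : Fin n => A.col j) ∧ maxMinor m A = Δ}

/-- The generalized Heller constant `h(Δ, m)`, the maximum of `hellerSet Δ m`. (The supremum
in `ℕ` is the maximum whenever the set is nonempty and bounded; it is `0` otherwise.) -/
noncomputable def heller (Δ m : ℕ) : ℕ := sSup (hellerSet Δ m)

/-!
Let `B` be an `m × m` submatrix of `A` with `|det B| = Δ`, and write the columns of `A` in the basis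
given by the columns of `B`. Cramer's rule, with `Δ` maximal, shows that all minors of every size of
the resulting set of rational vectors are at most `1` in absolute value
(`totallyOneSubmodular_coords`). The vectors are sorted by their fractional part `r ∈ [0, 1)^m`. The
lattice spanned by the columns of `B` has index `Δ`, so there are at most `Δ` classes, `r = 0`
being one of them (`card_image_fract_coords_le`).

Within one class, call `{i | c i ≠ r i}` the shifted support of `c`. At most two members of a class
share a shifted support, and the number of shifted supports is bounded by the Sauer–Shelah lemma:
it is at most `∑ i ≤ k, m.choose i` if no `k + 1` rows are shattered. What remains is to show that
few rows can be shattered, by exhibiting large minors.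

* For `r = 0` no three rows are shattered (`not_realizes_three_zero_rows`), which yields Heller's
  bound `m ^ 2 + m + 1` for that class (`card_le_of_hasFract_zero`).
* In general, suppose that one of the shattered rows can be frozen at a value `c₀` in such a way
  that on the columns with this entry each other row takes only two values. These two values differ
  by `1`, so the columns contain a unit cube at height `c₀`, and the simplices in this cube give
  minors that are `c₀` times their normalized volume (`abs_mul_abs_det_le_one`).
* For four shattered rows, a row with `r ∉ {0, 1/2}` can be frozen at some `|c₀| > 1/2`, and the
  regular tetrahedron, of normalized volume `2`, is a contradiction. For odd `Δ` the value `1/2`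
  does not occur in `r`, so no four rows are shattered (`not_realizes_four_of_ne_half`).
* For five shattered rows, all entries of `r` on them are therefore `0` or `1/2`. A separate argument
  (`exists_mul_eq_of_zero_row`) shows that some row with `r = 1/2` can be frozen at `c₀ = 1/2`, and
  a simplex of normalized volume `3` in the `4`-cube is a contradiction (`not_realizes_five`).
-/

/-! ### Totally 1-submodular sets and realized patterns -/

/-- A set `C` of column vectors is totally `1`-submodular if every minor of every size formed from
its members has absolute value at most `1`. Repeated rows or columns are allowed, since they only
contribute zero determinants. -/
def TotallyOneSubmodular {ι : Type*} (C : Set (ι → ℚ)) : Prop :=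
  ∀ (k : ℕ) (e : Fin k → ι) (c : Fin k → ι → ℚ), (∀ j, c j ∈ C) →
    |(Matrix.of fun i j => c j (e i)).det| ≤ 1

/-- All members of `C` lie in the coset of the integer vectors represented by `r ∈ [0, 1)^ι`. -/
def HasFract {ι : Type*} (C : Set (ι → ℚ)) (r : ι → ℚ) : Prop :=
  ∀ c ∈ C, ∀ i, Int.fract (c i) = r i

/-- The sets of coordinates on which the members of `C` differ from `r` have every possible trace
on the rows `e i`. For injective `e` this says that those sets shatter the range of `e`; in the
terminology of the subject, the rows `e` of `C` contain a Sauer matrix shifted by `r`. -/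
def Realizes {ι κ : Type*} (C : Set (ι → ℚ)) (r : ι → ℚ) (e : κ → ι) : Prop :=
  ∀ b : κ → Bool, ∃ c ∈ C, ∀ i, c (e i) ≠ r (e i) ↔ b i = true

lemma Realizes.comp {ι κ κ' : Type*} {C : Set (ι → ℚ)} {r : ι → ℚ} {e : κ → ι}
    (h : Realizes C r e) {f : κ' → κ} (hf : Function.Injective f) : Realizes C r (e ∘ f) := by
  intro b
  obtain ⟨c, hc, hb⟩ := h (Function.extend f b fun _ => false)
  refine ⟨c, hc, fun i => ?_⟩
  have := hb (f i)
  rwa [hf.extend_apply] at this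

section
variable {ι : Type*} {C : Set (ι → ℚ)} {r : ι → ℚ}

lemma TotallyOneSubmodular.abs_le_one (hC : TotallyOneSubmodular C) {c : ι → ℚ} (hc : c ∈ C)
    (i : ι) : |c i| ≤ 1 := by
  simpa using hC 1 (fun _ => i) (fun _ => c) (fun _ => hc)

lemma TotallyOneSubmodular.two (hC : TotallyOneSubmodular C) {c d : ι → ℚ} (hc : c ∈ C)
    (hd : d ∈ C) (i j : ι) : |c i * d j - d i * c j| ≤ 1 := by
  have := hC 2 ![i, j] ![c, d] (by intro j; fin_cases j <;> simp [hc, hd])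
  simpa [Matrix.det_fin_two] using this

lemma TotallyOneSubmodular.three (hC : TotallyOneSubmodular C) {c₀ c₁ c₂ : ι → ℚ}
    (h₀ : c₀ ∈ C) (h₁ : c₁ ∈ C) (h₂ : c₂ ∈ C) (i j k : ι) :
    |c₀ i * c₁ j * c₂ k - c₀ i * c₂ j * c₁ k - c₁ i * c₀ j * c₂ k + c₁ i * c₂ j * c₀ k
      + c₂ i * c₀ j * c₁ k - c₂ i * c₁ j * c₀ k| ≤ 1 := by
  have := hC 3 ![i, j, k] ![c₀, c₁, c₂] (by intro j; fin_cases j <;> simp [h₀, h₁, h₂])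
  simpa [Matrix.det_fin_three] using this

lemma HasFract.nonneg (hr : HasFract C r) {c : ι → ℚ} (hc : c ∈ C) (i : ι) : 0 ≤ r i :=
  hr c hc i ▸ Int.fract_nonneg _

lemma HasFract.lt_one (hr : HasFract C r) {c : ι → ℚ} (hc : c ∈ C) (i : ι) : r i < 1 :=
  hr c hc i ▸ Int.fract_lt_one _

/-- In a row with `r i = 0` the entries are `0`, `1`, `-1`. -/
lemma eq_one_or_eq_neg_one (hC : TotallyOneSubmodular C) (hr : HasFract C r) {c : ι → ℚ}
    (hc : c ∈ C) {i : ι} (hi : r i = 0) (h : c i ≠ 0) : c i = 1 ∨ c i = -1 := by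
  have h1 := Int.floor_add_fract (c i)
  rw [hr c hc i, hi, add_zero] at h1
  have h2 := abs_le.1 (hC.abs_le_one hc i)
  rw [← h1] at h2 h ⊢
  have h3 : -1 ≤ ⌊c i⌋ := by exact_mod_cast h2.1
  have h4 : ⌊c i⌋ ≤ 1 := by exact_mod_cast h2.2
  have h5 : ⌊c i⌋ ≠ 0 := by exact_mod_cast h
  have : ⌊c i⌋ = 1 ∨ ⌊c i⌋ = -1 := by omega
  exact_mod_cast this

lemma mul_self_eq_one (hC : TotallyOneSubmodular C) (hr : HasFract C r) {c : ι → ℚ}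
    (hc : c ∈ C) {i : ι} (hi : r i = 0) (h : c i ≠ 0) : c i * c i = 1 := by
  rcases eq_one_or_eq_neg_one hC hr hc hi h with h | h <;> rw [h] <;> norm_num

/-- In a row with `r i > 0` the entries are `r i` and `r i - 1`. -/
lemma eq_sub_one (hC : TotallyOneSubmodular C) (hr : HasFract C r) {c : ι → ℚ}
    (hc : c ∈ C) {i : ι} (hi : r i ≠ 0) (h : c i ≠ r i) : c i = r i - 1 := by
  have h1 := Int.floor_add_fract (c i)
  rw [hr c hc i] at h1
  have h2 := abs_le.1 (hC.abs_le_one hc i)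
  have h0 := lt_of_le_of_ne (hr.nonneg hc i) hi.symm
  have h0' := hr.lt_one hc i
  have h5 : ⌊c i⌋ ≠ 0 := by
    intro h5
    rw [h5] at h1
    exact h (by rw [← h1]; simp)
  have h3 : -2 < ⌊c i⌋ := by
    have : (-2 : ℚ) < ⌊c i⌋ := by linarith
    exact_mod_cast this
  have h4 : ⌊c i⌋ < 1 := by
    have : (⌊c i⌋ : ℚ) < 1 := by linarith
    exact_mod_cast this
  have : ⌊c i⌋ = -1 := by omega
  rw [this] at h1
  rw [← h1]; push_cast; ring

/-- In a row with `r i > 0` the entry of a member of `C` is determined by whether it equals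
`r i`. -/
lemma eq_of_iff_of_ne_zero (hC : TotallyOneSubmodular C) (hr : HasFract C r) {c d : ι → ℚ}
    (hc : c ∈ C) (hd : d ∈ C) {i : ι} (hi : r i ≠ 0) (h : c i ≠ r i ↔ d i ≠ r i) :
    c i = d i := by
  by_cases hci : c i = r i
  · have : d i = r i := by tauto
    rw [hci, this]
  · rw [eq_sub_one hC hr hc hi hci, eq_sub_one hC hr hd hi (by tauto)]

/-- Two rows with `r = 0` have a constant relative sign on the columns where both are nonzero. -/
lemma mul_eq_mul_of_zero_rows (hC : TotallyOneSubmodular C) (hr : HasFract C r) {c d : ι → ℚ}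
    (hc : c ∈ C) (hd : d ∈ C) {i j : ι} (hi : r i = 0) (hj : r j = 0)
    (hci : c i ≠ 0) (hcj : c j ≠ 0) (hdi : d i ≠ 0) (hdj : d j ≠ 0) :
    c i * c j = d i * d j := by
  have h := abs_le.1 (hC.two hc hd i j)
  rcases eq_one_or_eq_neg_one hC hr hc hi hci with h1 | h1 <;>
  rcases eq_one_or_eq_neg_one hC hr hc hj hcj with h2 | h2 <;>
  rcases eq_one_or_eq_neg_one hC hr hd hi hdi with h3 | h3 <;>
  rcases eq_one_or_eq_neg_one hC hr hd hj hdj with h4 | h4 <;>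
  first | (simp [h1, h2, h3, h4]; done) | norm_num [h1, h2, h3, h4] at h

/-! ### Unimodular rows shatter no three-element set -/

/-- The signs of the rows can be normalized so that the columns with supports `110`, `101`, `011`
become `0/1`-vectors; their determinant is then `±2`. -/
lemma not_realizes_three_zero_rows (hC : TotallyOneSubmodular C) (hr : HasFract C r)
    {e : Fin 3 → ι} (h0 : ∀ i, r (e i) = 0) : ¬ Realizes C r e := by
  intro h
  obtain ⟨s, hs, hs'⟩ := h ![true, true, true]
  obtain ⟨a, ha, ha'⟩ := h ![true, true, false]
  obtain ⟨b, hb, hb'⟩ := h ![true, false, true]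
  obtain ⟨d, hd, hd'⟩ := h ![false, true, true]
  simp only [h0, Fin.forall_fin_succ, Fin.isValue, Matrix.cons_val_zero, Matrix.cons_val_succ,
    Fin.succ_zero_eq_one, Fin.succ_one_eq_two, iff_true, Bool.false_eq_true,
    iff_false, not_not, IsEmpty.forall_iff, and_true, Matrix.cons_val_fin_one] at hs' ha' hb' hd'
  obtain ⟨s0, s1, s2⟩ := hs'
  obtain ⟨a0, a1, a2⟩ := ha'
  obtain ⟨b0, b1, b2⟩ := hb'
  obtain ⟨d0, d1, d2⟩ := hd'
  have h1 := mul_eq_mul_of_zero_rows hC hr ha hs (h0 0) (h0 1) a0 a1 s0 s1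
  have h2 := mul_eq_mul_of_zero_rows hC hr hb hs (h0 0) (h0 2) b0 b2 s0 s2
  have h3 := mul_eq_mul_of_zero_rows hC hr hd hs (h0 1) (h0 2) d1 d2 s1 s2
  have h4 := mul_self_eq_one hC hr hs (h0 0) s0
  have h5 := mul_self_eq_one hC hr hs (h0 1) s1
  have h6 := mul_self_eq_one hC hr hs (h0 2) s2
  have hdet := hC.three ha hb hd (e 0) (e 1) (e 2)
  rw [a2, b1, d0] at hdet
  have hsq := sq_le_one_iff_abs_le_one _ |>.2 hdet
  -- both terms of the determinant are `±1`, and their product is `1`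
  have hprod : (a (e 0) * d (e 1) * b (e 2)) * (b (e 0) * a (e 1) * d (e 2)) = 1 := by
    calc _ = (a (e 0) * a (e 1)) * (b (e 0) * b (e 2)) * (d (e 1) * d (e 2)) := by ring
      _ = (s (e 0) * s (e 0)) * (s (e 1) * s (e 1)) * (s (e 2) * s (e 2)) := by
        rw [h1, h2, h3]; ring
      _ = 1 := by rw [h4, h5, h6]; norm_num
  nlinarith [sq_nonneg (a (e 0) * d (e 1) * b (e 2) - b (e 0) * a (e 1) * d (e 2))]

/-! ### Simplices in a box -/

/-- Suppose that `C` realizes all patterns on the rows `e`, and that each other row takes only two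
values once the row `e 0` is frozen at `c₀`. These two values differ by `1`, so the columns with
entry `c₀` contain the vertices of an axis-parallel unit cube at height `c₀`, and each simplex spanned
by vertices of the cube gives a minor that is `c₀` times its normalized volume. -/
lemma abs_mul_abs_det_le_one (hC : TotallyOneSubmodular C) (hr : HasFract C r) {d : ℕ}
    {e : Fin (d + 1) → ι} (hR : Realizes C r e) {c₀ : ℚ} {b₀ : Bool}
    (hv : ∀ c ∈ C, (c (e 0) ≠ r (e 0) ↔ b₀ = true) → c (e 0) = c₀)
    (hcoh : ∀ j : Fin d, ∀ c ∈ C, ∀ c' ∈ C, c (e 0) = c₀ → c' (e 0) = c₀ →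
      (c (e j.succ) ≠ r (e j.succ) ↔ c' (e j.succ) ≠ r (e j.succ)) →
      c (e j.succ) = c' (e j.succ))
    (D : Matrix (Fin (d + 1)) (Fin (d + 1)) ℚ) (hD0 : ∀ j, D 0 j = 1)
    (hD : ∀ (i : Fin d) j, D i.succ j = 0 ∨ D i.succ j = 1) :
    |c₀| * |D.det| ≤ 1 := by
  choose col hcol hbit using fun j => hR (Fin.cons b₀ fun i => decide (D i.succ j = 1))
  obtain ⟨u, hu, hubit⟩ := hR (Fin.cons b₀ fun _ => true)
  have hcol0 : ∀ j, col j (e 0) = c₀ := fun j => hv _ (hcol j) (by simpa using hbit j 0)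
  have hu0 : u (e 0) = c₀ := hv _ hu (by simpa using hubit 0)
  have hune : ∀ i : Fin d, u (e i.succ) ≠ r (e i.succ) := fun i => by
    simpa using hubit i.succ
  set p : Fin d → ℚ := fun i => r (e i.succ) with hp
  set q : Fin d → ℚ := fun i => u (e i.succ) with hq
  have hstep : ∀ i, |q i - p i| = 1 := fun i => by
    by_cases h0 : p i = 0
    · rcases eq_one_or_eq_neg_one hC hr hu h0 (by rw [← h0]; exact hune i) with h | h <;>
      simp [h0, hq, h]
    · simp [hq, hp, eq_sub_one hC hr hu h0 (hune i)]
  have hentry : ∀ i j, col j (e i.succ) = p i + (q i - p i) * D i.succ j := fun i j => by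
    have hb := hbit j i.succ
    simp only [Fin.cons_succ, decide_eq_true_eq] at hb
    rcases hD i j with h | h
    · have : col j (e i.succ) = r (e i.succ) := by
        by_contra hne
        have := hb.1 hne
        rw [h] at this
        norm_num at this
      rw [this, h]; simp [hp]
    · have : col j (e i.succ) = u (e i.succ) :=
        hcoh i _ (hcol j) _ hu (hcol0 j) hu0 (iff_of_true (hb.2 h) (hune i))
      rw [this, h]; simp [hq]
  let T : Matrix (Fin (d + 1)) (Fin (d + 1)) ℚ :=
    Matrix.of (Fin.cons (Fin.cons c₀ fun _ => 0)
      fun i => Fin.cons (p i) (Matrix.diagonal (fun i => q i - p i) i))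
  have hT : T.det = c₀ * ∏ i, (q i - p i) := by
    rw [Matrix.det_succ_row_zero, Fin.sum_univ_succ]
    have hsub : T.submatrix Fin.succ (Fin.succAbove 0) = Matrix.diagonal fun i => q i - p i := by
      ext i j; simp [T]
    rw [hsub]
    simp [T]
  have hM : (Matrix.of fun i j => col j (e i)) = T * D := by
    ext i j
    rw [Matrix.mul_apply, Fin.sum_univ_succ]
    refine Fin.cases ?_ (fun i => ?_) i
    · simp [T, hcol0, hD0]
    · simp [T, hentry, hD0, Matrix.diagonal_apply]
  have := hC (d + 1) e col hcol
  rw [hM, Matrix.det_mul, hT, abs_mul, abs_mul, Finset.abs_prod] at this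
  simpa [hstep] using this

/-! ### Four shattered rows -/

/-- A row with `r ∉ {0, 1/2}` takes a value of absolute value more than `1/2`, on which the signs
in the rows with `r = 0` are constant. The regular tetrahedron in the unit cube then gives
a minor of absolute value more than `1`. -/
lemma eq_zero_or_eq_half_of_realizes_four (hC : TotallyOneSubmodular C) (hr : HasFract C r)
    {e : Fin 4 → ι} (hR : Realizes C r e) : r (e 0) = 0 ∨ r (e 0) = 1 / 2 := by
  by_contra hne
  push Not at hne
  obtain ⟨hne0, hne1⟩ := hne
  obtain ⟨b₀, c₀, hv, hc₀⟩ : ∃ (b₀ : Bool) (c₀ : ℚ),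
      (∀ c ∈ C, (c (e 0) ≠ r (e 0) ↔ b₀ = true) → c (e 0) = c₀) ∧ 1 / 2 < |c₀| := by
    rcases lt_or_gt_of_ne hne1 with h | h
    · refine ⟨true, r (e 0) - 1, fun c hc hb => eq_sub_one hC hr hc hne0 (by simpa using hb), ?_⟩
      rw [abs_of_neg (by linarith)]; linarith
    · refine ⟨false, r (e 0), fun c hc hb => by simpa using hb, ?_⟩
      rw [abs_of_pos (by linarith)]; linarith
  have key := abs_mul_abs_det_le_one hC hr hR hv ?_
    !![1, 1, 1, 1; 0, 1, 1, 0; 0, 1, 0, 1; 0, 0, 1, 1] ?_ ?_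
  · have hdet : |(!![1, 1, 1, 1; 0, 1, 1, 0; 0, 1, 0, 1; 0, 0, 1, 1] :
        Matrix (Fin 4) (Fin 4) ℚ).det| = 2 := by
      simp [Matrix.det_succ_row_zero, Fin.sum_univ_succ, Fin.succAbove]
      norm_num
    rw [hdet] at key
    linarith
  · intro j c hc c' hc' h0 h0' hb
    by_cases hj : r (e j.succ) = 0
    · by_cases hcj : c (e j.succ) = r (e j.succ)
      · rw [hcj]; by_contra hne; exact hb.2 (Ne.symm hne) hcj
      · have hcj' := hb.1 hcj
        rw [hj] at hcj hcj'
        have h2 := hC.two hc hc' (e 0) (e j.succ)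
        rw [h0, h0', ← mul_sub, abs_mul] at h2
        rcases eq_one_or_eq_neg_one hC hr hc hj hcj with h | h <;>
        rcases eq_one_or_eq_neg_one hC hr hc' hj hcj' with h' | h' <;>
        rw [h, h'] at h2 ⊢ <;> norm_num at h2 <;> linarith
    · exact eq_of_iff_of_ne_zero hC hr hc hc' hj hb
  · intro j; fin_cases j <;> rfl
  · intro i j; fin_cases i <;> fin_cases j <;> simp

/-- The same for an arbitrary one of at least four shattered rows. -/
lemma eq_zero_or_eq_half_of_realizes (hC : TotallyOneSubmodular C) (hr : HasFract C r) {k : ℕ}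
    (hk : 4 ≤ k) {e : Fin k → ι} (hR : Realizes C r e) (i : Fin k) :
    r (e i) = 0 ∨ r (e i) = 1 / 2 := by
  obtain ⟨k, rfl⟩ := Nat.exists_eq_add_of_le' hk
  have hR' := hR.comp (f := Equiv.swap 0 i ∘ Fin.castLE hk)
    ((Equiv.swap 0 i).injective.comp (Fin.castLE_injective hk))
  simpa [Function.comp_def] using eq_zero_or_eq_half_of_realizes_four hC hr hR'

/-- If `1/2` is excluded as well, then `r = 0` on all four rows, and three of them suffice. -/
lemma not_realizes_four_of_ne_half (hC : TotallyOneSubmodular C) (hr : HasFract C r)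
    (hne : ∀ i, r i ≠ 1 / 2) (e : Fin 4 → ι) : ¬ Realizes C r e := by
  intro hR
  refine not_realizes_three_zero_rows hC hr (e := e ∘ Fin.castSucc) (fun i => ?_)
    (hR.comp (Fin.castSucc_injective 3))
  exact (eq_zero_or_eq_half_of_realizes hC hr le_rfl hR _).resolve_right (hne _)

/-! ### Five shattered rows -/

set_option synthInstance.maxSize 4096 in
set_option synthInstance.maxHeartbeats 400000 in
/-- A set of vertices of the `3`-cube that meets every antipodal pair, and that does not contain
all three neighbours of any vertex, lies in a facet. -/
lemma exists_facet (f : Bool → Bool → Bool → Bool)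
    (hanti : ∀ x y z, f x y z = true ∨ f (!x) (!y) (!z) = true)
    (hcorner : ∀ x y z, ¬ (f (!x) y z = true ∧ f x (!y) z = true ∧ f x y (!z) = true)) :
    ∃ t : Bool, (∀ x y z, f x y z = true → x = t) ∨ (∀ x y z, f x y z = true → y = t) ∨
      (∀ x y z, f x y z = true → z = t) := by
  simp only [Bool.forall_bool, Bool.exists_bool, Bool.not_true, Bool.not_false] at *
  generalize f false false false = a₀ at *
  generalize f false false true = a₁ at *
  generalize f false true false = a₂ at *
  generalize f false true true = a₃ at *
  generalize f true false false = a₄ at *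
  generalize f true false true = a₅ at *
  generalize f true true false = a₆ at *
  generalize f true true true = a₇ at *
  revert a₀ a₁ a₂ a₃ a₄ a₅ a₆ a₇
  decide

/-- The value `±1/2` of a row with `r = 1/2`. -/
def halfSign (b : Bool) : ℚ := if b then 1 / 2 else -1 / 2

lemma det_vertex_neighbours (x y z : ℚ) :
    (!![0, 1, 1, 1; x, -x, x, x; y, y, -y, y; z, z, z, -z] : Matrix (Fin 4) (Fin 4) ℚ).det =
      -12 * x * y * z := by
  simp [Matrix.det_succ_row_zero, Fin.sum_univ_succ, Fin.succAbove]
  ring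

/-- A row `e 0` with `r = 0` is proportional, where it does not vanish, to one of any three rows
with `r = 1/2`, provided that all patterns are realized. Scale the columns with nonzero entry in
the row `e 0` so that this entry becomes `1`. The three other entries, times `2`, then form a
set of vertices of a cube, as in `exists_facet`: it meets all antipodal pairs because all
patterns are realized, and the three neighbours of a vertex `v` would give,
with the column `(0, v / 2)`, a minor `±3/2`. -/
lemma exists_mul_eq_of_zero_row (hC : TotallyOneSubmodular C) (hr : HasFract C r)
    {e : Fin 4 → ι} (hR : Realizes C r e) (h0 : r (e 0) = 0)
    (hhalf : ∀ i : Fin 3, r (e i.succ) = 1 / 2) :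
    ∃ (i : Fin 3) (s : ℚ), ∀ c ∈ C, c (e 0) ≠ 0 → c (e 0) * c (e i.succ) = s := by
  classical
  have hval : ∀ c ∈ C, ∀ i : Fin 3, ∃ b, c (e i.succ) = halfSign b := fun c hc i => by
    by_cases h : c (e i.succ) = r (e i.succ)
    · exact ⟨true, by rw [h, hhalf]; rfl⟩
    · refine ⟨false, ?_⟩
      rw [eq_sub_one hC hr hc (by rw [hhalf]; norm_num) h, hhalf, halfSign]
      norm_num
  have hval' : ∀ c ∈ C, c (e 0) ≠ 0 → ∀ i : Fin 3, ∃ b, c (e 0) * c (e i.succ) = halfSign b :=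
    fun c hc hne i => by
      obtain ⟨b, hb⟩ := hval c hc i
      rcases eq_one_or_eq_neg_one hC hr hc h0 hne with h | h
      · exact ⟨b, by rw [h, hb, one_mul]⟩
      · exact ⟨!b, by rw [h, hb]; cases b <;> norm_num [halfSign]⟩
  have hex : ∀ (x₀ x y z : Bool), ∃ c ∈ C, (c (e 0) ≠ 0 ↔ x₀ = true) ∧ c (e 1) = halfSign x ∧
      c (e 2) = halfSign y ∧ c (e 3) = halfSign z := by
    intro x₀ x y z
    obtain ⟨c, hc, hb⟩ := hR ![x₀, !x, !y, !z]
    have aux : ∀ (i : Fin 3) (b : Bool), (c (e i.succ) ≠ r (e i.succ) ↔ (!b) = true) →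
        c (e i.succ) = halfSign b := fun i b h => by
      obtain ⟨b', hb'⟩ := hval c hc i
      rw [hb', hhalf] at h
      rw [hb']
      cases b <;> cases b' <;> first | rfl | norm_num [halfSign] at h
    exact ⟨c, hc, by simpa [h0] using hb 0, aux 0 x (hb 1), aux 1 y (hb 2), aux 2 z (hb 3)⟩
  let P : Bool → Bool → Bool → Prop := fun x y z => ∃ c ∈ C, c (e 0) ≠ 0 ∧
    c (e 0) * c (e 1) = halfSign x ∧ c (e 0) * c (e 2) = halfSign y ∧
    c (e 0) * c (e 3) = halfSign z
  have hanti : ∀ x y z, P x y z ∨ P (!x) (!y) (!z) := by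
    intro x y z
    obtain ⟨c, hc, h1, h2, h3, h4⟩ := hex true x y z
    have hne : c (e 0) ≠ 0 := by simpa using h1
    rcases eq_one_or_eq_neg_one hC hr hc h0 hne with h | h
    · exact Or.inl ⟨c, hc, hne, by rw [h, h2, one_mul], by rw [h, h3, one_mul],
        by rw [h, h4, one_mul]⟩
    · refine Or.inr ⟨c, hc, hne, ?_, ?_, ?_⟩
      · rw [h, h2]; cases x <;> norm_num [halfSign]
      · rw [h, h3]; cases y <;> norm_num [halfSign]
      · rw [h, h4]; cases z <;> norm_num [halfSign]
  have hcorner : ∀ x y z, ¬ (P (!x) y z ∧ P x (!y) z ∧ P x y (!z)) := by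
    rintro x y z ⟨⟨a, ha, ha0, a1, a2, a3⟩, ⟨b, hb, hb0, b1, b2, b3⟩, ⟨d, hd, hd0, d1, d2, d3⟩⟩
    obtain ⟨c, hc, hc0, c1, c2, c3⟩ := hex false x y z
    have hc0 : c (e 0) = 0 := by simpa using hc0
    have hdet := hC 4 e ![c, a, b, d] (by intro j; fin_cases j <;> simp [hc, ha, hb, hd])
    have hneg : ∀ b, halfSign (!b) = -halfSign b := fun b => by cases b <;> norm_num [halfSign]
    have habs2 : ∀ b, |halfSign b| = 1 / 2 := fun b => by cases b <;> norm_num [halfSign, abs]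
    rw [hneg, mul_comm] at a1 b2 d3
    rw [mul_comm] at a2 a3 b1 b3 d1 d2
    have hM : (Matrix.of fun i j => (![c, a, b, d] : Fin 4 → ι → ℚ) j (e i)) *
        Matrix.diagonal ![1, a (e 0), b (e 0), d (e 0)] =
        !![0, 1, 1, 1; halfSign x, -halfSign x, halfSign x, halfSign x;
          halfSign y, halfSign y, -halfSign y, halfSign y;
          halfSign z, halfSign z, halfSign z, -halfSign z] := by
      ext i j
      rw [Matrix.mul_diagonal]
      fin_cases i <;> fin_cases j <;>
      simp [hc0, c1, c2, c3, a1, a2, a3, b1, b2, b3, d1, d2, d3,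
        mul_self_eq_one hC hr ha h0 ha0, mul_self_eq_one hC hr hb h0 hb0,
        mul_self_eq_one hC hr hd h0 hd0]
    have hdet' := congrArg abs (det_vertex_neighbours (halfSign x) (halfSign y) (halfSign z))
    simp only [abs_mul, habs2] at hdet'
    have habs : ∀ c ∈ C, c (e 0) ≠ 0 → |c (e 0)| = 1 := fun c hc hne => by
      rcases eq_one_or_eq_neg_one hC hr hc h0 hne with h | h <;> simp [h]
    rw [← hM, Matrix.det_mul, Matrix.det_diagonal, abs_mul, Finset.abs_prod] at hdet'
    simp only [Fin.prod_univ_four, Matrix.cons_val_zero, Matrix.cons_val_one, Matrix.cons_val,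
      habs a ha ha0, habs b hb hb0, habs d hd hd0, abs_one, mul_one] at hdet'
    rw [hdet'] at hdet
    norm_num [abs] at hdet
  have hP : ∀ c ∈ C, c (e 0) ≠ 0 → ∃ x y z, P x y z ∧ c (e 0) * c (e 1) = halfSign x ∧
      c (e 0) * c (e 2) = halfSign y ∧ c (e 0) * c (e 3) = halfSign z := fun c hc hne => by
    obtain ⟨x, hx⟩ := hval' c hc hne 0
    obtain ⟨y, hy⟩ := hval' c hc hne 1
    obtain ⟨z, hz⟩ := hval' c hc hne 2
    exact ⟨x, y, z, ⟨c, hc, hne, hx, hy, hz⟩, hx, hy, hz⟩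
  obtain ⟨t, h⟩ := exists_facet (fun x y z => decide (P x y z)) (by simpa using hanti)
    (by simpa using hcorner)
  simp only [decide_eq_true_eq] at h
  rcases h with h | h | h
  · refine ⟨0, halfSign t, fun c hc hne => ?_⟩
    obtain ⟨x, y, z, hp, hx, hy, hz⟩ := hP c hc hne
    rw [← h x y z hp]; exact hx
  · refine ⟨1, halfSign t, fun c hc hne => ?_⟩
    obtain ⟨x, y, z, hp, hx, hy, hz⟩ := hP c hc hne
    rw [← h x y z hp]; exact hy
  · refine ⟨2, halfSign t, fun c hc hne => ?_⟩
    obtain ⟨x, y, z, hp, hx, hy, hz⟩ := hP c hc hne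
    rw [← h x y z hp]; exact hz

/-- No five rows are shattered. By the results on four and on three rows, `r` is `0` or `1/2` in
every row, with at least three rows of the latter kind. Some row with `r = 1/2` is proportional to
all rows with `r = 0` on their supports, hence the signs are constant where it takes the value
`1/2`, and the `4`-dimensional `0/1`-simplex of normalized volume `3` gives a minor `±3/2`. -/
lemma not_realizes_five (hC : TotallyOneSubmodular C) (hr : HasFract C r) (e : Fin 5 → ι) :
    ¬ Realizes C r e := by
  intro hR
  have hval := eq_zero_or_eq_half_of_realizes hC hr (by norm_num) hR
  have hZ : (Finset.univ.filter fun i => r (e i) = 0).card < 3 := by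
    by_contra! h
    refine not_realizes_three_zero_rows hC hr (fun i => ?_)
      (hR.comp (Finset.orderEmbOfCardLe _ h).injective)
    exact (Finset.mem_filter.1 (Finset.orderEmbOfCardLe_mem _ h i)).2
  have hH : 3 ≤ (Finset.univ.filter fun i => ¬ r (e i) = 0).card := by
    have := Finset.card_filter_add_card_filter_not (s := Finset.univ) fun i => r (e i) = 0
    simp only [Finset.card_univ, Fintype.card_fin] at this
    omega
  set g := Finset.orderEmbOfCardLe _ hH with hg
  have hgH : ∀ i, r (e (g i)) = 1 / 2 := fun i =>
    (hval _).resolve_left (Finset.mem_filter.1 (Finset.orderEmbOfCardLe_mem _ hH i)).2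
  have hkey : ∀ z, r (e z) = 0 → ∃ (i : Fin 3) (s : ℚ), ∀ c ∈ C, c (e z) ≠ 0 →
      c (e z) * c (e (g i)) = s := by
    intro z hz
    have hinj : Function.Injective (Fin.cons z g : Fin 4 → Fin 5) := by
      refine Fin.cons_injective_iff.2 ⟨?_, g.injective⟩
      rintro ⟨i, rfl⟩
      have := hgH i
      rw [hz] at this
      norm_num at this
    simpa using exists_mul_eq_of_zero_row hC hr (hR.comp hinj) (by simpa using hz)
      (fun i => by simpa using hgH i)
  obtain ⟨i₀, hi₀, hprop⟩ : ∃ i₀, r (e i₀) = 1 / 2 ∧ ∀ z, r (e z) = 0 →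
      ∃ s, ∀ c ∈ C, c (e z) ≠ 0 → c (e z) * c (e i₀) = s := by
    by_cases hex : ∃ z, r (e z) = 0
    · obtain ⟨z, hz⟩ := hex
      obtain ⟨i, s, hs⟩ := hkey z hz
      refine ⟨g i, hgH i, fun z' hz' => ?_⟩
      obtain ⟨i', s', hs'⟩ := hkey z' hz'
      by_cases hii : g i' = g i
      · exact ⟨s', fun c hc hne => hii ▸ hs' c hc hne⟩
      -- if `z` and `z'` were proportional to different rows, then the relative sign
      -- of `z` and `z'` would not be constant
      exfalso
      have hne : ∀ i w, r (e w) = 0 → g i ≠ w := by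
        rintro i w hw rfl
        have := hgH i
        rw [hw] at this
        norm_num at this
      obtain ⟨c, hc, hcb⟩ := hR fun i => decide (i = z ∨ i = z')
      obtain ⟨d, hd, hdb⟩ := hR fun j => decide (j = z ∨ j = z' ∨ j = g i')
      simp only [decide_eq_true_eq] at hcb hdb
      have hcz : c (e z) ≠ 0 := by have := (hcb z).2 (by tauto); rwa [hz] at this
      have hcz' : c (e z') ≠ 0 := by have := (hcb z').2 (by tauto); rwa [hz'] at this
      have hdz : d (e z) ≠ 0 := by have := (hdb z).2 (by tauto); rwa [hz] at this
      have hdz' : d (e z') ≠ 0 := by have := (hdb z').2 (by tauto); rwa [hz'] at this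
      have hc1 : c (e (g i)) = 1 / 2 := by
        rw [← hgH i]; by_contra h
        rcases (hcb _).1 h with h | h
        exacts [hne i z hz h, hne i z' hz' h]
      have hc2 : c (e (g i')) = 1 / 2 := by
        rw [← hgH i']; by_contra h
        rcases (hcb _).1 h with h | h
        exacts [hne i' z hz h, hne i' z' hz' h]
      have hd1 : d (e (g i)) = 1 / 2 := by
        rw [← hgH i]; by_contra h
        rcases (hdb _).1 h with h | h | h
        exacts [hne i z hz h, hne i z' hz' h, hii h.symm]
      have hd2 : d (e (g i')) = -1 / 2 := by
        rw [eq_sub_one hC hr hd (by rw [hgH]; norm_num) ((hdb (g i')).2 (by tauto)), hgH]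
        norm_num
      have h1 := mul_eq_mul_of_zero_rows hC hr hc hd hz hz' hcz hcz' hdz hdz'
      have h2 := (hs c hc hcz).trans (hs d hd hdz).symm
      have h3 := (hs' c hc hcz').trans (hs' d hd hdz').symm
      rw [hc1, hd1] at h2
      rw [hc2, hd2] at h3
      have h4 : c (e z) = d (e z) := by linarith
      have h5 : c (e z') = -d (e z') := by linarith
      rw [h4, h5] at h1
      have h6 := mul_ne_zero hdz hdz'
      exact h6 (by linarith)
    · push Not at hex
      exact ⟨g 0, hgH 0, fun z hz => absurd hz (hex z)⟩
  have hR' := hR.comp (f := Equiv.swap 0 i₀) (Equiv.injective _)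
  have key := abs_mul_abs_det_le_one hC hr hR' (c₀ := 1 / 2) (b₀ := false) ?_ ?_
    !![1, 1, 1, 1, 1; 0, 0, 1, 1, 1; 0, 1, 0, 1, 1; 0, 1, 1, 0, 1; 0, 1, 1, 1, 0] ?_ ?_
  · have hdet : |(!![1, 1, 1, 1, 1; 0, 0, 1, 1, 1; 0, 1, 0, 1, 1; 0, 1, 1, 0, 1; 0, 1, 1, 1, 0] :
        Matrix (Fin 5) (Fin 5) ℚ).det| = 3 := by
      have : (!![1, 1, 1, 1, 1; 0, 0, 1, 1, 1; 0, 1, 0, 1, 1; 0, 1, 1, 0, 1; 0, 1, 1, 1, 0] :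
        Matrix (Fin 5) (Fin 5) ℚ).det = -3 := by
        simp [Matrix.det_succ_column_zero, Fin.sum_univ_succ, Fin.succAbove]
        norm_num
      rw [this]; norm_num
    rw [hdet] at key
    norm_num [abs] at key
  · intro c hc hb
    simpa [hi₀] using hb
  · intro j c hc c' hc' h0 h0' hb
    simp only [Function.comp_apply, Equiv.swap_apply_left] at h0 h0' hb ⊢
    set w := Equiv.swap 0 i₀ j.succ
    by_cases hw : r (e w) = 0
    · obtain ⟨s, hs⟩ := hprop w hw
      by_cases hcw : c (e w) = r (e w)
      · rw [hcw]; by_contra hne; exact hb.2 (Ne.symm hne) hcw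
      · have hcw' := hb.1 hcw
        rw [hw] at hcw hcw'
        have := (hs c hc hcw).trans (hs c' hc' hcw').symm
        rw [h0, h0'] at this
        linarith
    · exact eq_of_iff_of_ne_zero hC hr hc hc' hw hb
  · intro j; fin_cases j <;> rfl
  · intro i j; fin_cases i <;> fin_cases j <;> simp

/-! ### Counting the members of one coset -/

/-- Two distinct members of `C` that differ from `r` in the same rows are negatives of each other
in the rows with `r = 0`. -/
lemma eq_neg_of_zero_row (hC : TotallyOneSubmodular C) (hr : HasFract C r) {c d : ι → ℚ}
    (hc : c ∈ C) (hd : d ∈ C) (hcd : ∀ i, c i ≠ r i ↔ d i ≠ r i) (hne : c ≠ d) {i : ι}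
    (hi : r i = 0) : d i = -c i := by
  obtain ⟨j, hj⟩ := Function.ne_iff.1 hne
  have hrj : r j = 0 := by
    by_contra h
    exact hj (eq_of_iff_of_ne_zero hC hr hc hd h (hcd j))
  have hcj : c j ≠ 0 := fun h => by
    have := hcd j
    rw [hrj] at this
    exact hj (by rw [h]; by_contra h'; exact this.2 (Ne.symm h') h)
  have hdj : d j ≠ 0 := by have := (hcd j).1 (by rwa [hrj]); rwa [hrj] at this
  have hdj' : d j = -c j := by
    rcases eq_one_or_eq_neg_one hC hr hc hrj hcj with h | h <;>
    rcases eq_one_or_eq_neg_one hC hr hd hrj hdj with h' | h' <;>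
    rw [h, h'] at hj ⊢ <;> simp at hj ⊢
  by_cases hci : c i = 0
  · have : d i = 0 := by
      have := hcd i
      rw [hi] at this
      tauto
    rw [hci, this, neg_zero]
  · have hdi : d i ≠ 0 := by have := (hcd i).1 (by rwa [hi]); rwa [hi] at this
    have := mul_eq_mul_of_zero_rows hC hr hc hd hi hrj hci hcj hdi hdj
    rw [hdj'] at this
    exact mul_right_cancel₀ hcj (by linarith)

end

section
variable {ι : Type*} [Fintype ι] {r : ι → ℚ}

/-- The set of rows in which `c` differs from the shift `r`. -/
def shiftedSupport (r c : ι → ℚ) : Finset ι := Finset.univ.filter fun i => c i ≠ r i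

lemma shiftedSupport_eq_iff {c d : ι → ℚ} :
    shiftedSupport r c = shiftedSupport r d ↔ ∀ i, c i ≠ r i ↔ d i ≠ r i := by
  simp [shiftedSupport, Finset.ext_iff]

variable [DecidableEq ι]

lemma card_fiber_shiftedSupport_le_two {C : Finset (ι → ℚ)}
    (hC : TotallyOneSubmodular (C : Set (ι → ℚ))) (hr : HasFract (C : Set (ι → ℚ)) r)
    (S : Finset ι) : (C.filter fun c => shiftedSupport r c = S).card ≤ 2 := by
  by_contra! h
  obtain ⟨a, ha, b, hb, c, hc, hab, hac, hbc⟩ := Finset.two_lt_card.1 h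
  simp only [Finset.mem_filter] at ha hb hc
  have h1 := shiftedSupport_eq_iff.1 (ha.2.trans hb.2.symm)
  have h2 := shiftedSupport_eq_iff.1 (ha.2.trans hc.2.symm)
  have h3 := shiftedSupport_eq_iff.1 (hb.2.trans hc.2.symm)
  refine hbc (funext fun i => ?_)
  by_cases hi : r i = 0
  · rw [eq_neg_of_zero_row hC hr ha.1 hb.1 h1 hab hi, eq_neg_of_zero_row hC hr ha.1 hc.1 h2 hac hi]
  · exact eq_of_iff_of_ne_zero hC hr hb.1 hc.1 hi (h3 i)

/-- The Sauer–Shelah bound for the sets `shiftedSupport r c`. -/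
lemma card_image_shiftedSupport_le (C : Finset (ι → ℚ)) {k : ℕ}
    (hk : ∀ e : Fin (k + 1) → ι, Function.Injective e → ¬ Realizes (C : Set (ι → ℚ)) r e) :
    (C.image (shiftedSupport r)).card ≤ ∑ i ∈ Finset.range (k + 1), (Fintype.card ι).choose i := by
  have hvc : (C.image (shiftedSupport r)).vcDim ≤ k := by
    refine Finset.sup_le fun s hs => ?_
    rw [Finset.mem_shatterer] at hs
    by_contra! hlt
    obtain ⟨e⟩ : Nonempty (Fin (k + 1) ↪ s) :=
      Function.Embedding.nonempty_of_card_le (by simpa using hlt)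
    have hinj : Function.Injective fun i => (e i : ι) := Subtype.val_injective.comp e.injective
    refine hk (fun i => e i) hinj fun b => ?_
    obtain ⟨u, hu, hsu⟩ := hs
      (t := (Finset.univ.filter fun i => b i = true).image fun i => (e i : ι))
      (by intro x hx; simp only [Finset.mem_image] at hx; obtain ⟨i, -, rfl⟩ := hx; exact (e i).2)
    obtain ⟨c, hc, rfl⟩ := Finset.mem_image.1 hu
    refine ⟨c, hc, fun i => ?_⟩
    have := Finset.ext_iff.1 hsu (e i)
    simpa [shiftedSupport, hinj.eq_iff, Subtype.val_inj] using this
  refine (Finset.card_le_card_shatterer _).trans (Finset.card_shatterer_le_sum_vcDim.trans ?_)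
  refine Finset.sum_le_sum_of_subset fun i hi => ?_
  rw [Finset.mem_Iic] at hi
  rw [Finset.mem_range]
  omega

lemma card_le_two_mul_sum_choose {C : Finset (ι → ℚ)}
    (hC : TotallyOneSubmodular (C : Set (ι → ℚ))) (hr : HasFract (C : Set (ι → ℚ)) r) {k : ℕ}
    (hk : ∀ e : Fin (k + 1) → ι, Function.Injective e → ¬ Realizes (C : Set (ι → ℚ)) r e) :
    C.card ≤ 2 * ∑ i ∈ Finset.range (k + 1), (Fintype.card ι).choose i :=
  (Finset.card_le_mul_card_image (f := shiftedSupport r) C 2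
    fun S _ => card_fiber_shiftedSupport_le_two hC hr S).trans
    (Nat.mul_le_mul_left _ (card_image_shiftedSupport_le C hk))

/-- **Heller's theorem**: a totally unimodular matrix with `m` rows has at most `m ^ 2 + m + 1`
distinct columns. The supports shatter no three-element set, so there are at most
`1 + m + m.choose 2` of them; each belongs to at most two columns, and the empty one only to `0`. -/
lemma card_le_of_hasFract_zero {C : Finset (ι → ℚ)}
    (hC : TotallyOneSubmodular (C : Set (ι → ℚ))) (hr : HasFract (C : Set (ι → ℚ)) 0) :
    C.card ≤ Fintype.card ι ^ 2 + Fintype.card ι + 1 := by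
  -- adding the zero column ensures that the empty support occurs
  set C' := insert 0 C with hC'def
  have hC' : TotallyOneSubmodular (C' : Set (ι → ℚ)) := by
    intro k e c hc
    by_cases h0 : ∃ j, c j = 0
    · obtain ⟨j, hj⟩ := h0
      rw [Matrix.det_eq_zero_of_column_eq_zero j (fun i => by simp [hj])]
      simp
    · push Not at h0
      refine hC k e c fun j => ?_
      have := hc j
      simpa [hC'def, h0 j] using this
  have hr' : HasFract (C' : Set (ι → ℚ)) 0 := by
    intro c hc i
    rcases Finset.mem_insert.1 (Finset.mem_coe.1 hc) with rfl | hc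
    · simp
    · exact hr c hc i
  set A := C'.image (shiftedSupport 0) with hA
  have hcardA := card_image_shiftedSupport_le C' (r := 0) (k := 2)
    fun e _ => not_realizes_three_zero_rows hC' hr' fun _ => rfl
  have hempty : ∅ ∈ A := Finset.mem_image.2 ⟨0, Finset.mem_insert_self _ _, by
    simp [shiftedSupport]⟩
  have hfib0 : (C'.filter fun c => shiftedSupport 0 c = ∅).card ≤ 1 := by
    rw [Finset.card_le_one]
    have : ∀ c ∈ C'.filter fun c => shiftedSupport 0 c = ∅, c = 0 := fun c hc => by
      have := (Finset.mem_filter.1 hc).2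
      funext i
      by_contra h
      have : i ∈ shiftedSupport 0 c := by simpa [shiftedSupport] using h
      simp_all
    intro a ha b hb
    rw [this a ha, this b hb]
  have hcard : C'.card ≤ 1 + (A.card - 1) * 2 := by
    rw [Finset.card_eq_sum_card_image (shiftedSupport 0) C', ← hA,
      ← Finset.add_sum_erase _ _ hempty, ← Finset.card_erase_of_mem hempty]
    exact Nat.add_le_add hfib0 (Finset.sum_le_card_nsmul _ _ _
      fun S _ => card_fiber_shiftedSupport_le_two hC' hr' S)
  have hle : C.card ≤ C'.card := Finset.card_le_card (Finset.subset_insert _ _)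
  simp only [Finset.sum_range_succ, Finset.sum_range_zero, Nat.choose_zero_right,
    Nat.choose_one_right] at hcardA
  have h2 : (Fintype.card ι).choose 2 * 2 + Fintype.card ι = Fintype.card ι ^ 2 := by
    rw [Nat.choose_two_right, Nat.div_mul_cancel (Nat.even_mul_pred_self _).two_dvd]
    rcases Fintype.card ι with _ | n
    · rfl
    · simp; ring
  rw [← hA] at hcardA
  omega

end

/-! ### Coordinates with respect to a maximal minor -/

section
variable {m n : ℕ}

/-- The minor `maxMinor m A` also dominates determinants with columns repeated or out of order. -/
lemma natAbs_det_submatrix_le_maxMinor (A : Matrix (Fin m) (Fin n) ℤ) (f : Fin m → Fin n) :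
    (A.submatrix id f).det.natAbs ≤ maxMinor m A := by
  by_cases hf : Function.Injective f
  · have hmono : StrictMono (f ∘ Tuple.sort f) :=
      (Tuple.monotone_sort f).strictMono_of_injective (hf.comp (Tuple.sort f).injective)
    have h1 : (A.submatrix id (f ∘ Tuple.sort f)).det.natAbs = (A.submatrix id f).det.natAbs := by
      have := Matrix.det_permute' (Tuple.sort f) (A.submatrix id f)
      rw [Matrix.submatrix_submatrix, Function.comp_id] at this
      rw [this, Int.natAbs_mul]
      rcases Int.units_eq_one_or (Equiv.Perm.sign (Tuple.sort f)) with h | h <;> simp [h]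
    rw [← h1]
    exact Finset.le_sup (f := fun p : (Fin m ↪o Fin m) × (Fin m ↪o Fin n) =>
      (A.submatrix p.1 p.2).det.natAbs)
      (Finset.mem_univ (RelEmbedding.refl _, OrderEmbedding.ofStrictMono _ hmono))
  · obtain ⟨i, j, hij, hne⟩ := Function.not_injective_iff.1 hf
    rw [Matrix.det_zero_of_column_eq hne fun k => by simp [hij]]
    simp

lemma exists_natAbs_det_submatrix_eq_maxMinor (A : Matrix (Fin m) (Fin n) ℤ)
    (h : 0 < maxMinor m A) : ∃ g : Fin m → Fin n, (A.submatrix id g).det.natAbs = maxMinor m A := by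
  have hne : (Finset.univ : Finset ((Fin m ↪o Fin m) × (Fin m ↪o Fin n))).Nonempty := by
    by_contra hne
    rw [maxMinor, Finset.not_nonempty_iff_eq_empty.1 hne] at h
    simp at h
  obtain ⟨p, -, hp⟩ := Finset.exists_mem_eq_sup _ hne fun p => (A.submatrix p.1 p.2).det.natAbs
  have hp1 : (p.1 : Fin m → Fin m) = id := by
    refine (StrictMono.range_inj p.1.strictMono strictMono_id).1 ?_
    rw [Set.range_id, (Finite.injective_iff_surjective.1 p.1.injective).range_eq]
  rw [hp1] at hp
  exact ⟨p.2, hp.symm⟩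

/-- The coordinates of an integer vector with respect to the columns of `B`. -/
noncomputable def coords (B : Matrix (Fin m) (Fin m) ℤ) (v : Fin m → ℤ) : Fin m → ℚ :=
  (B.map (Int.castRingHom ℚ))⁻¹.mulVec fun i => (v i : ℚ)

lemma isUnit_det_map {B : Matrix (Fin m) (Fin m) ℤ} (hB : B.det ≠ 0) :
    IsUnit (B.map (Int.castRingHom ℚ)).det := by
  have h : (B.map (Int.castRingHom ℚ)).det = (B.det : ℚ) :=
    ((Int.castRingHom ℚ).map_det B).symm
  rw [h, isUnit_iff_ne_zero]
  exact_mod_cast hB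

lemma mulVec_coords {B : Matrix (Fin m) (Fin m) ℤ} (hB : B.det ≠ 0) (v : Fin m → ℤ) :
    (B.map (Int.castRingHom ℚ)).mulVec (coords B v) = fun i => (v i : ℚ) := by
  rw [coords, Matrix.mulVec_mulVec, Matrix.mul_nonsing_inv _ (isUnit_det_map hB),
    Matrix.one_mulVec]

lemma coords_mulVec {B : Matrix (Fin m) (Fin m) ℤ} (hB : B.det ≠ 0) (y : Fin m → ℤ) :
    coords B (B.mulVec y) = fun i => (y i : ℚ) := by
  have h : (fun i => ((B.mulVec y i : ℤ) : ℚ)) =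
      (B.map (Int.castRingHom ℚ)).mulVec fun i => (y i : ℚ) := by
    ext i; simp [Matrix.mulVec, dotProduct]
  rw [coords, h, Matrix.mulVec_mulVec, Matrix.nonsing_inv_mul _ (isUnit_det_map hB),
    Matrix.one_mulVec]

lemma coords_sub (B : Matrix (Fin m) (Fin m) ℤ) (v w : Fin m → ℤ) :
    coords B (v - w) = coords B v - coords B w := by
  rw [coords, coords, coords, ← Matrix.mulVec_sub]
  congr 1; ext i; simp

lemma coords_smul (B : Matrix (Fin m) (Fin m) ℤ) (z : ℤ) (v : Fin m → ℤ) :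
    coords B (z • v) = (z : ℚ) • coords B v := by
  rw [coords, coords, ← Matrix.mulVec_smul]
  congr 1; ext i; simp

lemma coords_injective {B : Matrix (Fin m) (Fin m) ℤ} (hB : B.det ≠ 0) :
    Function.Injective (coords B) := by
  intro v w h
  have := (mulVec_coords hB v).symm.trans ((congrArg _ h).trans (mulVec_coords hB w))
  ext i
  exact_mod_cast congrFun this i

/-- Cramer's rule: `det B` is a common denominator of the coordinates. -/
lemma exists_int_eq_det_mul_coords {B : Matrix (Fin m) (Fin m) ℤ} (hB : B.det ≠ 0)
    (v : Fin m → ℤ) (i : Fin m) : ∃ z : ℤ, (B.det : ℚ) * coords B v i = z := by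
  refine ⟨B.adjugate.mulVec v i, ?_⟩
  have h := coords_mulVec hB (B.adjugate.mulVec v)
  rw [Matrix.mulVec_mulVec, Matrix.mul_adjugate, Matrix.smul_mulVec, Matrix.one_mulVec,
    coords_smul] at h
  simpa using congrFun h i

/-- In the coordinates given by a maximal minor `B`, every minor of size `k` is a quotient
`det M / det B`, where `M` arises from `B` by exchanging `k` columns for other columns of `A`. -/
lemma totallyOneSubmodular_coords (A : Matrix (Fin m) (Fin n) ℤ) {g : Fin m → Fin n}
    (hg : (A.submatrix id g).det.natAbs = maxMinor m A) (hpos : 0 < maxMinor m A) :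
    TotallyOneSubmodular (Set.range fun j => coords (A.submatrix id g) (A.col j)) := by
  set B := A.submatrix id g with hBdef
  have hB : B.det ≠ 0 := fun h => by rw [h] at hg; simp at hg; omega
  set x : Fin n → Fin m → ℚ := fun j => coords B (A.col j) with hx
  have hxg : ∀ l i, x (g l) i = (1 : Matrix (Fin m) (Fin m) ℚ) i l := fun l i => by
    have h := congrFun (coords_mulVec hB (Pi.single l 1)) i
    rw [Matrix.mulVec_single_one] at h
    rw [Matrix.one_apply]
    refine Eq.trans ?_ (h.trans ?_)
    · rfl
    · simp [Pi.single_apply]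
  intro k e c hc
  choose js hjs using hc
  by_cases he : Function.Injective e
  swap
  · obtain ⟨i, j, hij, hne⟩ := Function.not_injective_iff.1 he
    rw [Matrix.det_zero_of_row_eq hne (by ext l; simp [hij])]
    simp
  let E : Matrix (Fin m) (Fin k) ℚ := (1 : Matrix (Fin m) (Fin m) ℚ).submatrix id e
  let X : Matrix (Fin m) (Fin k) ℚ := Matrix.of fun i j => c j i
  let h : Fin m → Fin n := Function.extend e js g
  have hEE : E.transpose * E = 1 := by
    ext i j
    simp [E, Matrix.mul_apply, Matrix.one_apply, he.eq_iff]
  have hEX : E.transpose * X = Matrix.of fun i j => c j (e i) := by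
    ext i j
    simp [E, X, Matrix.mul_apply, Matrix.one_apply]
  have hdet : (1 + (X - E) * E.transpose).det = (Matrix.of fun i j => c j (e i)).det := by
    rw [Matrix.det_one_add_mul_comm, Matrix.mul_sub, hEE, hEX]
    congr 1
    abel
  have hN : 1 + (X - E) * E.transpose = Matrix.of fun i l => x (h l) i := by
    ext i l
    by_cases hl : ∃ a, e a = l
    · obtain ⟨a, rfl⟩ := hl
      simp [E, X, h, Matrix.mul_apply, Matrix.one_apply, he.extend_apply, he.eq_iff, ← hjs, hx]
    · have hl' : ∀ a, l ≠ e a := fun a ha => hl ⟨a, ha.symm⟩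
      have hl' : ∀ a, e a ≠ l := fun a ha => hl ⟨a, ha⟩
      simp [E, h, Matrix.mul_apply, hxg, Matrix.one_apply, hl']
  have hBN : B.map (Int.castRingHom ℚ) * (1 + (X - E) * E.transpose) =
      (A.submatrix id h).map (Int.castRingHom ℚ) := by
    rw [hN]
    ext i l
    have := congrFun (mulVec_coords hB (A.col (h l))) i
    simpa [Matrix.mul_apply, Matrix.mulVec, dotProduct, hx] using this
  have h1 := congrArg Matrix.det hBN
  rw [Matrix.det_mul, hdet] at h1
  have hB1 : (B.map (Int.castRingHom ℚ)).det = (B.det : ℚ) := ((Int.castRingHom ℚ).map_det B).symm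
  have hA1 : ((A.submatrix id h).map (Int.castRingHom ℚ)).det = ((A.submatrix id h).det : ℚ) :=
    ((Int.castRingHom ℚ).map_det _).symm
  rw [hB1, hA1] at h1
  have hle : |((A.submatrix id h).det : ℚ)| ≤ |(B.det : ℚ)| := by
    have := natAbs_det_submatrix_le_maxMinor A h
    rw [← hg] at this
    have h2 : |(A.submatrix id h).det| ≤ |B.det| := by
      rw [Int.abs_eq_natAbs, Int.abs_eq_natAbs]
      exact_mod_cast this
    exact_mod_cast h2
  rw [← h1, abs_mul] at hle
  have hBpos : 0 < |(B.det : ℚ)| := abs_pos.2 (by exact_mod_cast hB)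
  exact le_of_mul_le_mul_left (by simpa using hle) hBpos

/-- The fractional part of the coordinates depends only on the class modulo the lattice spanned by
the columns of `B`, which has index `|det B|`. -/
lemma card_image_fract_coords_le {B : Matrix (Fin m) (Fin m) ℤ} (hB : B.det ≠ 0)
    (S : Finset (Fin m → ℤ)) :
    (S.image fun v i => Int.fract (coords B v i)).card ≤ B.det.natAbs := by
  have hinj : Function.Injective (Matrix.toLin' B) := by
    intro v w h
    simp only [Matrix.toLin'_apply] at h
    have := (coords_mulVec hB v).symm.trans ((congrArg _ h).trans (coords_mulVec hB w))
    ext i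
    exact_mod_cast congrFun this i
  let N := LinearMap.range (Matrix.toLin' B)
  have hcard : Nat.card ((Fin m → ℤ) ⧸ N) = B.det.natAbs := by
    rw [← Submodule.natAbs_det_equiv N (LinearEquiv.ofInjective _ hinj), ← LinearMap.det_toLin' B]
    congr 2
  have hfin : Finite ((Fin m → ℤ) ⧸ N) :=
    Nat.finite_of_card_ne_zero (by rw [hcard]; exact Int.natAbs_ne_zero.2 hB)
  let F : ((Fin m → ℤ) ⧸ N) → Fin m → ℚ :=
    Quotient.lift (fun v i => Int.fract (coords B v i)) (by
      intro v w hvw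
      obtain ⟨y, hy⟩ := (Submodule.quotientRel_def N).1 hvw
      rw [Matrix.toLin'_apply] at hy
      have h := coords_mulVec hB y
      rw [hy, coords_sub] at h
      ext i
      exact Int.fract_eq_fract.2 ⟨y i, congrFun h i⟩)
  have hsub : ((S.image fun v i => Int.fract (coords B v i) : Finset (Fin m → ℚ)) :
      Set (Fin m → ℚ)) ⊆ Set.range F := by
    intro t ht
    obtain ⟨v, -, rfl⟩ := Finset.mem_image.1 (Finset.mem_coe.1 ht)
    exact ⟨Submodule.Quotient.mk v, rfl⟩
  rw [← hcard, ← Set.ncard_coe_finset]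
  refine (Set.ncard_le_ncard hsub (Set.finite_range F)).trans ?_
  rw [← Set.image_univ, ← Set.ncard_univ]
  exact Set.ncard_image_le

/-! ### The upper bound -/

/-- If no `k + 1` rows of a coset can be shattered, the coset of `0` contributes at most
`m ^ 2 + m + 1` columns, and each of the other at most `Δ - 1` cosets contributes at most
`2 * ∑ i ≤ k, m.choose i`. -/
lemma le_of_mem_hellerSet {Δ : ℕ} (hΔ : 0 < Δ) (hm : 0 < m) {k : ℕ}
    (hk : ∀ (C : Set (Fin m → ℚ)) (r : Fin m → ℚ), TotallyOneSubmodular C → HasFract C r →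
      (∀ i, ∃ z : ℤ, (Δ : ℚ) * r i = z) →
      ∀ e : Fin (k + 1) → Fin m, Function.Injective e → ¬ Realizes C r e)
    (hn : n ∈ hellerSet Δ m) :
    n ≤ m ^ 2 + m + 1 + (Δ - 1) * (2 * ∑ i ∈ Finset.range (k + 1), m.choose i) := by
  classical
  obtain ⟨-, A, hA, hmax⟩ := hn
  subst hmax
  obtain ⟨g, hg⟩ := exists_natAbs_det_submatrix_eq_maxMinor A hΔ
  have hsub := totallyOneSubmodular_coords A hg hΔ
  set B := A.submatrix id g
  have hB : B.det ≠ 0 := fun h => by rw [h] at hg; simp at hg; omega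
  set x : Fin n → Fin m → ℚ := fun j => coords B (A.col j)
  have hxinj : Function.Injective x := (coords_injective hB).comp hA
  set fr : (Fin m → ℚ) → Fin m → ℚ := fun c i => Int.fract (c i) with hfr
  set D : Finset (Fin m → ℚ) := Finset.univ.image x with hD
  have hDcard : D.card = n := by
    rw [hD, Finset.card_image_of_injective _ hxinj, Finset.card_univ, Fintype.card_fin]
  set R := D.image fr with hR
  have hRcard : R.card ≤ maxMinor m A := by
    have := card_image_fract_coords_le hB (Finset.univ.image A.col)
    rw [hg] at this
    convert this using 2
    rw [hR, hD, Finset.image_image, Finset.image_image]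
    rfl
  have hsubD : ∀ r, TotallyOneSubmodular ((D.filter fun c => fr c = r : Finset _) :
      Set (Fin m → ℚ)) := fun r k e c hc => hsub k e c fun j => by
    have h := (Finset.mem_filter.1 (Finset.mem_coe.1 (hc j))).1
    obtain ⟨l, -, hl⟩ := Finset.mem_image.1 h
    exact ⟨l, hl⟩
  have hfrD : ∀ r, HasFract ((D.filter fun c => fr c = r : Finset _) : Set (Fin m → ℚ)) r :=
    fun r c hc i => congrFun (Finset.mem_filter.1 (Finset.mem_coe.1 hc)).2 i
  have h0 : (D.filter fun c => fr c = 0).card ≤ m ^ 2 + m + 1 := by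
    simpa using card_le_of_hasFract_zero (hsubD 0) (hfrD 0)
  have hr : ∀ r ∈ R, (D.filter fun c => fr c = r).card ≤
      2 * ∑ i ∈ Finset.range (k + 1), m.choose i := by
    intro r hr
    have hint : ∀ i, ∃ z : ℤ, ((maxMinor m A : ℕ) : ℚ) * r i = z := by
      intro i
      obtain ⟨c, hc, rfl⟩ := Finset.mem_image.1 hr
      obtain ⟨j, -, rfl⟩ := Finset.mem_image.1 hc
      obtain ⟨z, hz⟩ := exists_int_eq_det_mul_coords hB (A.col j) i
      rw [← hg]
      have h2 : (B.det : ℚ) * fr (x j) i = ((z - B.det * ⌊x j i⌋ : ℤ) : ℚ) := by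
        rw [Int.cast_sub, Int.cast_mul, ← hz, ← mul_sub]
        rfl
      rcases Int.natAbs_eq B.det with h | h
      · refine ⟨z - B.det * ⌊x j i⌋, ?_⟩
        rw [← h2]
        congr 1
        have : (B.det.natAbs : ℤ) = B.det := h.symm
        rw [← Int.cast_natCast, this]
      · refine ⟨-(z - B.det * ⌊x j i⌋), ?_⟩
        rw [Int.cast_neg, ← h2, ← neg_mul]
        congr 1
        have : (B.det.natAbs : ℤ) = -B.det := by omega
        rw [← Int.cast_natCast, this, Int.cast_neg]
    simpa using card_le_two_mul_sum_choose (hsubD r) (hfrD r)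
      (hk _ r (hsubD r) (hfrD r) hint)
  have h0R : (0 : Fin m → ℚ) ∈ R := by
    -- the columns of `B` have integral coordinates
    refine Finset.mem_image.2 ⟨x (g ⟨0, hm⟩), Finset.mem_image_of_mem _ (Finset.mem_univ _), ?_⟩
    have h := coords_mulVec hB (Pi.single ⟨0, hm⟩ 1)
    rw [Matrix.mulVec_single_one] at h
    have h' : x (g ⟨0, hm⟩) = fun i => (((Pi.single ⟨0, hm⟩ 1 : Fin m → ℤ) i : ℤ) : ℚ) := h
    ext i
    simp only [hfr, h', Int.fract_intCast, Pi.zero_apply]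
  calc n = ∑ r ∈ R, (D.filter fun c => fr c = r).card := by
        rw [← hDcard, hR, ← Finset.card_eq_sum_card_image]
    _ = (D.filter fun c => fr c = 0).card + ∑ r ∈ R.erase 0, (D.filter fun c => fr c = r).card :=
        (Finset.add_sum_erase _ _ h0R).symm
    _ ≤ (m ^ 2 + m + 1) + (R.erase 0).card * (2 * ∑ i ∈ Finset.range (k + 1), m.choose i) :=
        Nat.add_le_add h0 (Finset.sum_le_card_nsmul _ _ _
          fun r h => hr r (Finset.mem_of_mem_erase h))
    _ ≤ _ := by
        rw [Finset.card_erase_of_mem h0R]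
        gcongr

end

/-! ### The generalized Heller constant -/

/-- The matrix `diag(Δ, 1, …, 1)` shows that the maximum is taken over a nonempty set. -/
lemma mem_hellerSet_self {Δ m : ℕ} (hΔ : 0 < Δ) (hm : 0 < m) : m ∈ hellerSet Δ m := by
  let d : Fin m → ℤ := fun i => if i = ⟨0, hm⟩ then Δ else 1
  have hd : ∀ i, d i ≠ 0 := fun i => by
    simp only [d]; split_ifs <;> omega
  have hdet : (Matrix.diagonal d).det = Δ := by
    rw [Matrix.det_diagonal]
    simp [d, Finset.prod_ite_eq']
  have hle := natAbs_det_submatrix_le_maxMinor (Matrix.diagonal d) id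
  rw [Matrix.submatrix_id_id, hdet, Int.natAbs_natCast] at hle
  refine ⟨hm, Matrix.diagonal d, fun i j hij => ?_, le_antisymm ?_ hle⟩
  · by_contra hne
    have := congrFun hij i
    simp [Matrix.col, Matrix.diagonal_apply_ne _ hne, hd] at this
  · obtain ⟨g, hg⟩ := exists_natAbs_det_submatrix_eq_maxMinor _ (hΔ.trans_le hle)
    rw [← hg]
    by_cases hinj : Function.Injective g
    · let σ : Equiv.Perm (Fin m) := Equiv.ofBijective g
        ((Fintype.bijective_iff_injective_and_card g).2 ⟨hinj, rfl⟩)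
      have := Matrix.det_permute' σ (Matrix.diagonal d)
      rw [hdet] at this
      change ((Matrix.diagonal d).submatrix id σ).det.natAbs ≤ Δ
      rw [this, Int.natAbs_mul]
      rcases Int.units_eq_one_or (Equiv.Perm.sign σ) with h | h <;> simp [h]
    · obtain ⟨i, j, hij, hne⟩ := Function.not_injective_iff.1 hinj
      rw [Matrix.det_zero_of_column_eq hne fun k => by simp [hij]]
      simp

/-- Boundedness needs no result on shattering, since `m + 1` rows are never distinct. -/
lemma isGreatest_heller {Δ m : ℕ} (hΔ : 0 < Δ) (hm : 0 < m) :
    IsGreatest (hellerSet Δ m) (heller Δ m) := by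
  have hbdd : BddAbove (hellerSet Δ m) :=
    ⟨_, fun n hn => le_of_mem_hellerSet hΔ hm (k := m) (fun C r _ _ _ e he => absurd
      (Fintype.card_le_of_injective e he) (by simp)) hn⟩
  exact ⟨Nat.sSup_mem ⟨m, mem_hellerSet_self hΔ hm⟩ hbdd, fun n hn => le_csSup hbdd hn⟩

lemma heller_le {Δ m : ℕ} (hΔ : 0 < Δ) (hm : 0 < m) {k : ℕ}
    (hk : ∀ (C : Set (Fin m → ℚ)) (r : Fin m → ℚ), TotallyOneSubmodular C → HasFract C r →
      (∀ i, ∃ z : ℤ, (Δ : ℚ) * r i = z) →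
      ∀ e : Fin (k + 1) → Fin m, Function.Injective e → ¬ Realizes C r e) :
    (heller Δ m : ℝ) ≤ (m : ℝ) ^ 2 + m + 1
        + 2 * ((Δ : ℝ) - 1) * ∑ i ∈ Finset.range (k + 1), (m.choose i : ℝ) := by
  have h := le_of_mem_hellerSet hΔ hm hk (isGreatest_heller hΔ hm).1
  have h' : (heller Δ m : ℝ) ≤ ((m ^ 2 + m + 1 +
      (Δ - 1) * (2 * ∑ i ∈ Finset.range (k + 1), m.choose i) : ℕ) : ℝ) := by exact_mod_cast h
  refine h'.trans (le_of_eq ?_)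
  push_cast [Nat.cast_sub (Nat.succ_le_of_lt hΔ)]
  ring

lemma ne_half_of_odd_mul_eq_int {Δ : ℕ} (hodd : Odd Δ) {q : ℚ} (h : ∃ z : ℤ, (Δ : ℚ) * q = z) :
    q ≠ 1 / 2 := by
  rintro rfl
  obtain ⟨z, hz⟩ := h
  obtain ⟨t, rfl⟩ := hodd
  have : ((2 * t + 1 : ℕ) : ℤ) = 2 * z := by
    have h2 : ((2 * t + 1 : ℕ) : ℚ) = 2 * (z : ℚ) := by linarith
    exact_mod_cast h2
  omega

lemma upper_bound_isBigO {Δ m k : ℕ} (hΔ : 0 < Δ) (hm : 0 < m) (hk : 2 ≤ k) :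
    (m : ℝ) ^ 2 + m + 1 + 2 * ((Δ : ℝ) - 1) * ∑ i ∈ Finset.range (k + 1), (m.choose i : ℝ)
      ≤ (2 * k + 5) * (m : ℝ) ^ k * Δ := by
  have hm1 : (1 : ℝ) ≤ m := by exact_mod_cast hm
  have hΔ1 : (1 : ℝ) ≤ Δ := by exact_mod_cast hΔ
  have hpow : ∀ i ≤ k, (m : ℝ) ^ i ≤ (m : ℝ) ^ k := fun i hi => pow_le_pow_right₀ hm1 hi
  have hsum : ∑ i ∈ Finset.range (k + 1), (m.choose i : ℝ) ≤ (k + 1) * (m : ℝ) ^ k := by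
    calc _ ≤ ∑ i ∈ Finset.range (k + 1), (m : ℝ) ^ k := Finset.sum_le_sum fun i hi => by
          refine le_trans ?_ (hpow i (by rw [Finset.mem_range] at hi; omega))
          exact_mod_cast Nat.choose_le_pow m i
      _ = _ := by simp
  have h0 := hpow 0 (by omega)
  have h1 := hpow 1 (by omega)
  have h2 := hpow 2 hk
  rw [pow_zero] at h0
  rw [pow_one] at h1
  have h3 : 2 * ((Δ : ℝ) - 1) * ∑ i ∈ Finset.range (k + 1), (m.choose i : ℝ) ≤
      2 * ((Δ : ℝ) - 1) * ((k + 1) * (m : ℝ) ^ k) :=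
    mul_le_mul_of_nonneg_left hsum (by linarith)
  have h4 : 0 ≤ ((Δ : ℝ) - 1) * (m : ℝ) ^ k := by
    apply mul_nonneg <;> [linarith; positivity]
  have h5 : 0 ≤ (k : ℝ) * (m : ℝ) ^ k := by positivity
  nlinarith

theorem theorem1 :
    -- for all positive `Δ` and `m` the maximum defining `h(Δ, m)` exists
    (∀ Δ m : ℕ, 0 < Δ → 0 < m → IsGreatest (hellerSet Δ m) (heller Δ m)) ∧
    -- (i)
    (∀ Δ m : ℕ, 0 < Δ → 5 ≤ m →
      (heller Δ m : ℝ) ≤ (m : ℝ) ^ 2 + m + 1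
        + 2 * ((Δ : ℝ) - 1) * ∑ i ∈ Finset.range 5, (m.choose i : ℝ)) ∧
    (∃ C : ℝ, 0 < C ∧ ∀ Δ m : ℕ, 0 < Δ → 5 ≤ m →
      (m : ℝ) ^ 2 + m + 1 + 2 * ((Δ : ℝ) - 1) * ∑ i ∈ Finset.range 5, (m.choose i : ℝ)
        ≤ C * (m : ℝ) ^ 4 * Δ) ∧
    -- (ii)
    (∀ Δ m : ℕ, 0 < Δ → Odd Δ → 4 ≤ m →
      (heller Δ m : ℝ) ≤ (m : ℝ) ^ 2 + m + 1
        + 2 * ((Δ : ℝ) - 1) * ∑ i ∈ Finset.range 4, (m.choose i : ℝ)) ∧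
    (∃ C : ℝ, 0 < C ∧ ∀ Δ m : ℕ, 0 < Δ → Odd Δ → 4 ≤ m →
      (m : ℝ) ^ 2 + m + 1 + 2 * ((Δ : ℝ) - 1) * ∑ i ∈ Finset.range 4, (m.choose i : ℝ)
        ≤ C * (m : ℝ) ^ 3 * Δ) := by
  refine ⟨fun Δ m hΔ hm => isGreatest_heller hΔ hm, fun Δ m hΔ hm => ?_, ?_,
    fun Δ m hΔ hodd hm => ?_, ?_⟩
  · exact heller_le hΔ (by omega) (k := 4) fun C r hC hr _ e _ => not_realizes_five hC hr e
  · exact ⟨2 * (4 : ℕ) + 5, by norm_num, fun Δ m hΔ hm =>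
      upper_bound_isBigO (k := 4) hΔ (by omega) (by norm_num)⟩
  · exact heller_le hΔ (by omega) (k := 3) fun C r hC hr hint e _ =>
      not_realizes_four_of_ne_half hC hr (fun i => ne_half_of_odd_mul_eq_int hodd (hint i)) e
  · exact ⟨2 * (3 : ℕ) + 5, by norm_num, fun Δ m hΔ _ hm =>
      upper_bound_isBigO (k := 3) hΔ (by omega) (by norm_num)⟩
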